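/- Let $m\ge 2$ be an integer, let $\omega_m=e^{2\pi i/m}$, and let $a\in\mathbb{C}\setminus\{0,-1,-2,\dots\}$ be such that none of the numbers $a-\omega_m^r(a+k)$ with $1\le r\le m-1$ and $k\in\{0,1,2,\dots\}$ is a pole of the Gamma function, i.e. none of them lies in $\{0,-1,-2,\dots\}$. If $m=2$, assume in addition that $\operatorname{Re}(a)<2$. Let $\zeta(m,a)=\sum_{k=0}^{\infty}\frac{1}{(a+k)^m}$ denote the Hurwitz zeta function. Then this series converges absolutely, and $$\zeta(m,a)=\sum_{k=0}^{\infty}\frac{m(-1)^{k}\prod_{r=1}^{m-1}\Gamma\bigl(a-\omega_m^{r}(a+k)\bigr)}{\Gamma(a)^m\,k!\,(a+k)^{m+1}},$$ where the series on the right converges (possibly only conditionally) in the sense of its partial sums $\sum_{k=0}^{N-1}$ as $N\to\infty$. -/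

import Mathlib

/-- The Hurwitz zeta function `ζ(m, a) = ∑_{k ≥ 0} 1 / (a + k) ^ m` at an integer `m ≥ 2` and a
complex parameter `a ∉ {0, -1, -2, …}`. Mathlib's `HurwitzZeta.hurwitzZeta` has its parameter in
`ℝ / ℤ`, hence does not cover a general complex `a`. -/
noncomputable def hurwitzZetaNat (m : ℕ) (a : ℂ) : ℂ :=
  ∑' k : ℕ, 1 / (a + (k : ℂ)) ^ m

/-- The primitive `m`-th root of unity `ω_m = exp (2 π i / m)`. -/
noncomputable def omegaRoot (m : ℕ) : ℂ :=
  Complex.exp (2 * (Real.pi : ℂ) * Complex.I / (m : ℂ))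

/-- The `k`-th term
`m (-1)^k ∏_{r=1}^{m-1} Γ(a - ω_m^r (a + k)) / (Γ(a)^m k! (a + k)^(m+1))`. -/
noncomputable def pfsTerm (m : ℕ) (a : ℂ) (k : ℕ) : ℂ :=
  (m : ℂ) * (-1) ^ k *
      (∏ r ∈ Finset.Ico 1 m, Complex.Gamma (a - omegaRoot m ^ r * (a + (k : ℂ)))) /
    (Complex.Gamma a ^ m * (k.factorial : ℂ) * (a + (k : ℂ)) ^ (m + 1))

open Filter Topology Finset

/-! Put x_k = (a+k)^(-m). For M distinct nodes, ∑ x_k^M / ∏_{j≠k} (x_k - x_j) = ∑ x_k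
(`sum_pow_card_div_prod_sub`), which rewrites the M-th partial sum of ζ(m, a) as a sum of terms
`truncTerm m a M k`. Splitting x^m - y^m over the m-th roots of unity turns each term into a
quotient of Euler products `Complex.GammaSeq`, so it tends to `pfsTerm m a k` (`truncTerm_eq`,
`tendsto_truncTerm`). It remains to exchange limit and sum.

For m ≥ 3 the k-th term is bounded, uniformly in M, by a power of k times (k!/k^k)^(m-2)
(`norm_truncTerm_le`), and dominated convergence applies.

For m = 2 this decay is lost. The truncated terms are `pfsTerm 2 a k` times weights `truncRatio a n
k` that tend to 1 and have bounded variation in k, uniformly for large n. By Abel summation the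
weighted sums share the limit of the series, once the series converges; Re a < 2 gives that by
pairing consecutive, nearly opposite terms. -/

/-! ### Roots of unity and the finite identity -/

theorem omegaRoot_isPrimitiveRoot {m : ℕ} (hm : m ≠ 0) : IsPrimitiveRoot (omegaRoot m) m :=
  Complex.isPrimitiveRoot_exp m hm

/-- The term of index `k` in the partial fraction expansion of the complete homogeneous symmetric
polynomial of degree one in the `M` variables `(a + j) ^ (-m)`, `j < M`. -/
noncomputable def truncTerm (m : ℕ) (a : ℂ) (M k : ℕ) : ℂ :=
  1 / (a + k) ^ m * ∏ j ∈ (range M).erase k, (a + j) ^ m / ((a + j) ^ m - (a + k) ^ m)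

theorem pow_sub_pow_eq_prod_omegaRoot {m : ℕ} (hm : 0 < m) (x y : ℂ) :
    x ^ m - y ^ m = (x - y) * ∏ r ∈ Ico 1 m, (x - omegaRoot m ^ r * y) := by
  have h := omegaRoot_isPrimitiveRoot hm.ne'
  have himg : (range m).image (omegaRoot m ^ ·) = Polynomial.nthRootsFinset m (1 : ℂ) := by
    refine eq_of_subset_of_card_le (fun z hz => ?_) ?_
    · obtain ⟨r, -, rfl⟩ := mem_image.1 hz
      rw [Polynomial.mem_nthRootsFinset hm, ← pow_mul, mul_comm, pow_mul, h.pow_eq_one, one_pow]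
    · rw [h.card_nthRootsFinset, card_image_of_injOn h.injOn_pow, card_range]
  rw [h.pow_sub_pow_eq_prod_sub_mul x y hm, ← himg, prod_image h.injOn_pow, range_eq_Ico,
    prod_eq_prod_Ico_succ_bot hm]
  simp

theorem prod_one_sub_omegaRoot {m : ℕ} (hm : 0 < m) :
    ∏ r ∈ Ico 1 m, (1 - omegaRoot m ^ r) = m := by
  obtain ⟨n, rfl⟩ := Nat.exists_eq_succ_of_ne_zero hm.ne'
  have h := (omegaRoot_isPrimitiveRoot hm.ne').prod_one_sub_pow_eq_order
  rw [prod_Ico_eq_prod_range]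
  simpa [add_comm] using h

theorem sum_omegaRoot {m : ℕ} (hm : 2 ≤ m) : ∑ r ∈ Ico 1 m, omegaRoot m ^ r = -1 := by
  have h := (omegaRoot_isPrimitiveRoot (m := m) (by omega)).geom_sum_eq_zero (by omega)
  rw [range_eq_Ico, sum_eq_sum_Ico_succ_bot (by omega)] at h
  simp only [pow_zero, zero_add] at h
  linear_combination h

theorem add_natCast_pow_ne {m : ℕ} (hm : 2 ≤ m) {a : ℂ}
    (hpole : ∀ r ∈ Ico 1 m, ∀ k j : ℕ, a - omegaRoot m ^ r * (a + (k : ℂ)) ≠ -(j : ℂ))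
    {j k : ℕ} (hjk : j ≠ k) : (a + j) ^ m - (a + k) ^ m ≠ 0 := by
  rw [pow_sub_pow_eq_prod_omegaRoot (by omega)]
  refine mul_ne_zero (by simpa [sub_eq_zero] using hjk) (prod_ne_zero_iff.2 fun r hr h => ?_)
  exact hpole r hr k j (by linear_combination h)

/-- X^n - ∏ (X - x_i) has degree < n and takes the value x_i^n at each node; compare its coefficient
of X^(n-1) with that of its Lagrange interpolant. -/
theorem sum_pow_card_div_prod_sub {ι F : Type*} [DecidableEq ι] [Field F] (s : Finset ι) {x : ι → F}
    (hx : Set.InjOn x s) :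
    ∑ i ∈ s, x i ^ #s / ∏ j ∈ s.erase i, (x i - x j) = ∑ i ∈ s, x i := by
  rcases s.eq_empty_or_nonempty with rfl | hs
  · simp
  have hc : 0 < #s := hs.card_pos
  set P : Polynomial F := Polynomial.X ^ #s - ∏ i ∈ s, (Polynomial.X - Polynomial.C (x i)) with hP
  have hdeg : P.degree < (s.card : WithBot ℕ) := by
    have h1 : (∏ i ∈ s, (Polynomial.X - Polynomial.C (x i))).degree = (s.card : WithBot ℕ) := by
      simp [Polynomial.degree_prod]
    have := Polynomial.degree_sub_lt_left (p := Polynomial.X ^ s.card)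
      (q := ∏ i ∈ s, (Polynomial.X - Polynomial.C (x i))) (by simp [h1])
      (by simp) (by
        rw [(Polynomial.monic_prod_of_monic _ _ fun i _ =>
          Polynomial.monic_X_sub_C (x i)).leadingCoeff]
        simp)
    simpa [hP] using this
  have h := Lagrange.coeff_eq_sum hx hdeg
  rw [hP, Polynomial.coeff_sub, Polynomial.prod_X_sub_C_coeff_card_pred s x hc,
    Polynomial.coeff_X_pow, if_neg (by omega), zero_sub, neg_neg] at h
  rw [h]
  refine sum_congr rfl fun i hi => ?_
  rw [Polynomial.eval_sub, Polynomial.eval_prod, prod_eq_zero hi (by simp)]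
  simp

/-- Nodes x_k = (a+k)^(-m), distinct by the pole hypothesis; x_k / (x_k - x_j) is the j-th factor of
`truncTerm`. -/
theorem sum_truncTerm {m : ℕ} (hm : 2 ≤ m) {a : ℂ} (ha : ∀ j : ℕ, a ≠ -(j : ℂ))
    (hpole : ∀ r ∈ Ico 1 m, ∀ k j : ℕ, a - omegaRoot m ^ r * (a + (k : ℂ)) ≠ -(j : ℂ)) (M : ℕ) :
    ∑ k ∈ range M, truncTerm m a M k = ∑ k ∈ range M, 1 / (a + (k : ℂ)) ^ m := by
  have h0 : ∀ j : ℕ, (a + j) ^ m ≠ 0 := fun j =>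
    pow_ne_zero _ fun h => ha j (by linear_combination h)
  rw [← sum_pow_card_div_prod_sub (range M) (x := fun k : ℕ => 1 / (a + (k : ℂ)) ^ m)]
  · refine sum_congr rfl fun k hk => ?_
    rw [truncTerm, card_range]
    obtain ⟨n, rfl⟩ : ∃ n, M = n + 1 := ⟨M - 1, by have := mem_range.1 hk; omega⟩
    have hcard : #((range (n + 1)).erase k) = n := by rw [card_erase_of_mem hk, card_range]; simp
    rw [pow_succ', mul_div_assoc]
    congr 1
    rw [← hcard, ← prod_const, hcard, ← prod_div_distrib]
    refine prod_congr rfl fun j hj => ?_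
    have h1 := add_natCast_pow_ne hm hpole (mem_erase.1 hj).1
    have h2 := h0 j
    have h3 := h0 k
    rw [div_sub_div _ _ h3 h2, div_div_div_eq]
    field_simp
  · intro j _ k _ h
    by_contra hjk
    refine add_natCast_pow_ne hm hpole hjk ?_
    have := inv_injective (by simpa using h : ((a + j) ^ m)⁻¹ = ((a + k) ^ m)⁻¹)
    rw [this, sub_self]

/-! ### Truncated terms as Euler products, and their limits -/

theorem prod_erase_natCast_sub (k l : ℕ) :
    ∏ j ∈ (range (k + l + 1)).erase k, ((j : ℂ) - k) = (-1) ^ k * k.factorial * l.factorial := by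
  induction l with
  | zero =>
    rw [add_zero, range_add_one, erase_insert (by simp), ← prod_range_reflect]
    have : ∀ j ∈ range k, (((k - 1 - j : ℕ) : ℂ) - k) = -1 * ((j + 1 : ℕ) : ℂ) := by
      intro j hj
      have := mem_range.1 hj
      rw [Nat.cast_sub (by omega), Nat.cast_sub (by omega)]
      push_cast; ring
    rw [prod_congr rfl this, prod_mul_distrib, prod_const, card_range, ← Nat.cast_prod,
      prod_range_add_one_eq_factorial]
    simp
  | succ l ih =>
    rw [show k + (l + 1) + 1 = (k + l + 1) + 1 by ring, range_add_one,
      erase_insert_of_ne (by omega), prod_insert (by simp), ih, Nat.factorial_succ]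
    push_cast; ring

/-- In (a+j)^m - (a+k)^m the trivial root contributes (-1)^k k! l!, every other r the denominator of
`GammaSeq (s r)`. Since the ω^r with r ≥ 1 sum to -1, the powers n^(s r) multiply to n^(m a + k);
the last factor corrects the surplus n^k. -/
theorem truncTerm_eq {m : ℕ} (hm : 2 ≤ m) {a : ℂ} (ha : ∀ j : ℕ, a ≠ -(j : ℂ))
    (hpole : ∀ r ∈ Ico 1 m, ∀ k j : ℕ, a - omegaRoot m ^ r * (a + (k : ℂ)) ≠ -(j : ℂ)) (k l : ℕ)
    (hkl : k + l ≠ 0) :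
    truncTerm m a (k + l + 1) k =
      (m : ℂ) * (-1) ^ k *
        (∏ r ∈ Ico 1 m, Complex.GammaSeq (a - omegaRoot m ^ r * (a + (k : ℂ))) (k + l)) /
      (Complex.GammaSeq a (k + l) ^ m * (k.factorial : ℂ) * (a + (k : ℂ)) ^ (m + 1)) *
      ((k + l).factorial / (l.factorial * ((k + l : ℕ) : ℂ) ^ k)) := by
  have hk : k ∈ range (k + l + 1) := by simp
  have hak : a + k ≠ 0 := fun h => ha k (by linear_combination h)
  have hn : ((k + l : ℕ) : ℂ) ≠ 0 := by exact_mod_cast hkl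
  have hPa : ∏ j ∈ range (k + l + 1), (a + (j : ℂ)) ≠ 0 :=
    prod_ne_zero_iff.2 fun j _ h => ha j (by linear_combination h)
  set s : ℕ → ℂ := fun r => a - omegaRoot m ^ r * (a + (k : ℂ)) with hs
  have hsj : ∀ r ∈ Ico 1 m, ∀ j : ℕ, s r + j ≠ 0 := fun r hr j h =>
    hpole r hr k j (by linear_combination h)
  have hsum : ∑ r ∈ Ico 1 m, s r = m * a + k := by
    rw [hs, sum_sub_distrib, ← sum_mul, sum_omegaRoot hm, sum_const, Nat.card_Ico, nsmul_eq_mul,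
      Nat.cast_sub (by omega)]
    push_cast; ring
  have hcpow : ∏ r ∈ Ico 1 m, ((k + l : ℕ) : ℂ) ^ s r =
      (((k + l : ℕ) : ℂ) ^ a) ^ m * ((k + l : ℕ) : ℂ) ^ k := by
    rw [← Complex.cpow_nat_mul, ← Complex.cpow_natCast _ k, ← Complex.cpow_add _ _ hn, ← hsum,
      Complex.cpow_def_of_ne_zero hn, mul_sum, Complex.exp_sum]
    exact prod_congr rfl fun r _ => Complex.cpow_def_of_ne_zero hn _
  -- The factors at j = k, absent from the erased product; they produce the m and the exponent m + 1
  -- of `pfsTerm`.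
  have hsk : ∏ r ∈ Ico 1 m, (s r + k) = m * (a + k) ^ (m - 1) := by
    have : ∀ r ∈ Ico 1 m, s r + k = (1 - omegaRoot m ^ r) * (a + k) := fun r _ => by
      simp only [hs]; ring
    rw [prod_congr rfl this, prod_mul_distrib, prod_one_sub_omegaRoot (by omega), prod_const,
      Nat.card_Ico]
  have hQ : ∏ r ∈ Ico 1 m, ∏ j ∈ range (k + l + 1), (s r + (j : ℂ)) ≠ 0 :=
    prod_ne_zero_iff.2 fun r hr => prod_ne_zero_iff.2 fun j _ => hsj r hr j
  have hsk0 : ∏ r ∈ Ico 1 m, (s r + k) ≠ 0 := prod_ne_zero_iff.2 fun r hr => hsj r hr k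
  have hden : ∏ j ∈ (range (k + l + 1)).erase k, ((a + j) ^ m - (a + k) ^ m) =
      (-1) ^ k * k.factorial * l.factorial *
        ((∏ r ∈ Ico 1 m, ∏ j ∈ range (k + l + 1), (s r + (j : ℂ))) / (m * (a + k) ^ (m - 1))) := by
    have h1 : ∀ j ∈ (range (k + l + 1)).erase k, (a + j) ^ m - (a + k) ^ m =
        ((j : ℂ) - k) * ∏ r ∈ Ico 1 m, (s r + j) := fun j _ => by
      rw [pow_sub_pow_eq_prod_omegaRoot (by omega)]
      congr 1
      · ring
      · exact prod_congr rfl fun r _ => by simp only [hs]; ring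
    rw [prod_congr rfl h1, prod_mul_distrib, prod_erase_natCast_sub, Finset.prod_comm, ← hsk,
      eq_comm, ← prod_div_distrib]
    congr 1
    refine prod_congr rfl fun r hr => ?_
    rw [div_eq_iff (hsj r hr k), prod_erase_mul _ _ hk]
  have hnum : ∏ j ∈ (range (k + l + 1)).erase k, (a + (j : ℂ)) ^ m =
      (∏ j ∈ range (k + l + 1), (a + (j : ℂ))) ^ m / (a + k) ^ m := by
    rw [eq_div_iff (pow_ne_zero _ hak), prod_erase_mul _ _ hk, prod_pow]
  have hGs : ∏ r ∈ Ico 1 m, Complex.GammaSeq (s r) (k + l) =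
      (((k + l : ℕ) : ℂ) ^ a) ^ m * ((k + l : ℕ) : ℂ) ^ k * ((k + l).factorial : ℂ) ^ (m - 1) /
        ∏ r ∈ Ico 1 m, ∏ j ∈ range (k + l + 1), (s r + (j : ℂ)) := by
    simp only [Complex.GammaSeq]
    rw [prod_div_distrib, prod_mul_distrib, hcpow, prod_const, Nat.card_Ico]
  rw [truncTerm, prod_div_distrib, hden, hnum, hGs, Complex.GammaSeq]
  rw [hsk] at hsk0
  have hf1 : ((k + l).factorial : ℂ) ≠ 0 := by exact_mod_cast Nat.factorial_ne_zero _
  have hf2 : (k.factorial : ℂ) ≠ 0 := by exact_mod_cast Nat.factorial_ne_zero _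
  have hf3 : (l.factorial : ℂ) ≠ 0 := by exact_mod_cast Nat.factorial_ne_zero _
  have hna : ((k + l : ℕ) : ℂ) ^ a ≠ 0 := fun h =>
    hn ((Complex.cpow_eq_zero_iff _ _).1 h).1
  have hm0 : (m : ℂ) ≠ 0 := by exact_mod_cast (by omega : m ≠ 0)
  have hneg : ((-1 : ℂ) ^ k) * (-1) ^ k = 1 := by rw [← mul_pow]; simp
  have hneg0 : ((-1 : ℂ) ^ k) ≠ 0 := by simp
  generalize ∏ r ∈ Ico 1 m, ∏ j ∈ range (k + l + 1), (s r + (j : ℂ)) = Q at *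
  generalize ∏ j ∈ range (k + l + 1), (a + (j : ℂ)) = P at *
  generalize ((k + l : ℕ) : ℂ) ^ a = A at *
  generalize ((k + l : ℕ) : ℂ) = n at *
  generalize ((k + l).factorial : ℂ) = F at *
  generalize (-1 : ℂ) ^ k = e at *
  obtain ⟨p, rfl⟩ : ∃ p, m = p + 1 := ⟨m - 1, by omega⟩
  simp only [Nat.add_sub_cancel]
  rw [div_pow, mul_pow]
  field_simp
  linear_combination (-F * F ^ p * (a + k) ^ (2 * p + 2)) * hneg

theorem tendsto_factorial_div_pow (k : ℕ) :
    Tendsto (fun l : ℕ => ((k + l).factorial / (l.factorial * ((k + l : ℕ) : ℂ) ^ k) : ℂ)) atTop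
      (𝓝 1) := by
  have h := ((Asymptotics.isEquivalent_iff_tendsto_one ?_).1 (isEquivalent_descFactorial k)).comp
    (tendsto_add_atTop_nat k)
  · have h2 := (Complex.continuous_ofReal.tendsto 1).comp h
    rw [Complex.ofReal_one] at h2
    refine h2.congr fun l => ?_
    have := Nat.factorial_mul_descFactorial (n := k + l) (k := k) (by omega)
    rw [Nat.add_sub_cancel_left] at this
    have hf3 : (l.factorial : ℂ) ≠ 0 := by exact_mod_cast Nat.factorial_ne_zero _
    simp only [Function.comp_apply, Pi.div_apply, add_comm l k, ← this]
    push_cast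
    field_simp
  · filter_upwards [eventually_gt_atTop 0] with n hn
    positivity

theorem tendsto_truncTerm {m : ℕ} (hm : 2 ≤ m) {a : ℂ} (ha : ∀ j : ℕ, a ≠ -(j : ℂ))
    (hpole : ∀ r ∈ Ico 1 m, ∀ k j : ℕ, a - omegaRoot m ^ r * (a + (k : ℂ)) ≠ -(j : ℂ)) (k : ℕ) :
    Tendsto (fun M => truncTerm m a M k) atTop (𝓝 (pfsTerm m a k)) := by
  rw [← tendsto_add_atTop_iff_nat (k + 1)]
  have hak : a + k ≠ 0 := fun h => ha k (by linear_combination h)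
  have hG : ∀ s : ℂ, Tendsto (fun l : ℕ => Complex.GammaSeq s (k + l)) atTop
      (𝓝 (Complex.Gamma s)) := fun s => by
    simpa [add_comm] using (tendsto_add_atTop_iff_nat k).2 (Complex.GammaSeq_tendsto_Gamma s)
  have h := (((tendsto_const_nhds (x := (m : ℂ) * (-1) ^ k)).mul
    (tendsto_finsetProd (Ico 1 m) fun r _ => hG (a - omegaRoot m ^ r * (a + (k : ℂ))))).div
    ((((hG a).pow m).mul_const (k.factorial : ℂ)).mul_const ((a + (k : ℂ)) ^ (m + 1)))
    (mul_ne_zero (mul_ne_zero (pow_ne_zero _ (Complex.Gamma_ne_zero ha))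
      (by exact_mod_cast Nat.factorial_ne_zero _)) (pow_ne_zero _ hak))).mul
    (tendsto_factorial_div_pow k)
  rw [mul_one] at h
  refine h.congr' ?_
  filter_upwards [eventually_gt_atTop 0] with l hl
  rw [show l + (k + 1) = k + l + 1 by ring, truncTerm_eq hm ha hpole k l (by omega)]
  rfl

/-! ### Bounds for truncated terms, uniform in the truncation -/

theorem exp_neg_two_mul_le_one_sub {x : ℝ} (h0 : 0 ≤ x) (h1 : x ≤ 1 / 2) :
    Real.exp (-2 * x) ≤ 1 - x := by
  have h2 : 0 < 1 + 2 * x := by linarith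
  calc Real.exp (-2 * x) = (Real.exp (2 * x))⁻¹ := by rw [← Real.exp_neg]; ring_nf
    _ ≤ (1 + 2 * x)⁻¹ := inv_anti₀ h2 (by linarith [Real.add_one_le_exp (2 * x)])
    _ ≤ 1 - x := by
      rw [inv_le_iff_one_le_mul₀ h2]
      nlinarith

/-- The deviation of w from p is proportional to 1 - p, so w^m - p^m is small relative to 1 - p^m,
and nothing is lost as p → 1. -/
theorem norm_one_sub_pow_ge {w ε : ℂ} {p B : ℝ} (hp0 : 0 ≤ p) (hp1 : p ≤ 1)
    (hw : w - p = ε * (1 - p)) (hwB : ‖w‖ ≤ B) (hpB : p ≤ B) {m : ℕ} (hm : 1 ≤ m) :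
    (1 - p ^ m) * (1 - ‖ε‖ * (m * B ^ (m - 1))) ≤ ‖1 - w ^ m‖ := by
  have hB : 0 ≤ B := hp0.trans hpB
  have hpm : p ^ m ≤ p := pow_le_of_le_one hp0 hp1 (by omega)
  have hsum : ‖∑ i ∈ range m, w ^ i * (p : ℂ) ^ (m - 1 - i)‖ ≤ m * B ^ (m - 1) := by
    refine (norm_sum_le _ _).trans ?_
    refine (sum_le_card_nsmul _ _ (B ^ (m - 1)) fun i hi => ?_).trans_eq (by simp)
    have : m - 1 = i + (m - 1 - i) := by have := mem_range.1 hi; omega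
    rw [norm_mul, norm_pow, norm_pow, Complex.norm_real, Real.norm_of_nonneg hp0]
    calc ‖w‖ ^ i * p ^ (m - 1 - i) ≤ B ^ i * B ^ (m - 1 - i) := by gcongr
      _ = B ^ (m - 1) := by rw [← pow_add, ← this]
  have hdiff : ‖w ^ m - (p : ℂ) ^ m‖ ≤ ‖ε‖ * (m * B ^ (m - 1)) * (1 - p ^ m) := by
    rw [← (Commute.all w (p : ℂ)).geom_sum₂_mul, hw, norm_mul, norm_mul]
    have : ‖(1 - p : ℂ)‖ = 1 - p := by
      rw [← Complex.ofReal_one, ← Complex.ofReal_sub, Complex.norm_real,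
        Real.norm_of_nonneg (by linarith)]
    rw [this]
    calc _ ≤ m * B ^ (m - 1) * (‖ε‖ * (1 - p ^ m)) := by gcongr
      _ = _ := by ring
  have hre : ‖(1 - (p : ℂ) ^ m)‖ = 1 - p ^ m := by
    rw [← Complex.ofReal_one, ← Complex.ofReal_pow, ← Complex.ofReal_sub, Complex.norm_real,
      Real.norm_of_nonneg (by linarith)]
  have h3 := norm_sub_norm_le (1 - (p : ℂ) ^ m) (w ^ m - (p : ℂ) ^ m)
  rw [hre, show 1 - (p : ℂ) ^ m - (w ^ m - (p : ℂ) ^ m) = 1 - w ^ m by ring] at h3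
  linarith

theorem prod_range_erase {R : Type*} [CommMonoid R] (f : ℕ → R) (k n : ℕ) :
    ∏ j ∈ (range (k + 1 + n)).erase k, f j =
      (∏ j ∈ range k, f j) * ∏ i ∈ range n, f (k + 1 + i) := by
  induction n with
  | zero => rw [add_zero, range_add_one, erase_insert (by simp)]; simp
  | succ n ih =>
    rw [← add_assoc, range_add_one, erase_insert_of_ne (by omega), prod_insert (by simp), ih,
      prod_range_succ, mul_comm, mul_assoc]

theorem prod_one_sub_div_sq (k : ℕ) (hk : k ≠ 0) :
    ∏ j ∈ range k, (1 - ((j : ℝ) / k) ^ 2) =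
      ((2 * k).factorial : ℝ) / (2 * (k : ℝ) ^ (2 * k)) := by
  have hk0 : (k : ℝ) ≠ 0 := by exact_mod_cast hk
  have h1 : ∏ j ∈ range k, ((k : ℝ) - j) = (k.factorial : ℝ) := by
    rw [← prod_range_add_one_eq_factorial, ← prod_range_reflect, Nat.cast_prod]
    refine prod_congr rfl fun j hj => ?_
    have := mem_range.1 hj
    rw [Nat.cast_sub (by omega), Nat.cast_sub (by omega)]
    push_cast; ring
  have h2 : (k.factorial : ℝ) * (2 * ∏ j ∈ range k, ((k : ℝ) + j)) = ((2 * k).factorial : ℝ) := by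
    have h3 : (k + 1).ascFactorial k = 2 * k.ascFactorial k :=
      Nat.eq_of_mul_eq_mul_left (Nat.pos_of_ne_zero hk) (by rw [Nat.succ_ascFactorial]; ring)
    have h4 := Nat.factorial_mul_ascFactorial k k
    rw [h3, Nat.ascFactorial_eq_prod_range, ← two_mul] at h4
    exact_mod_cast h4
  have h5 : ∀ j ∈ range k, (1 - ((j : ℝ) / k) ^ 2) = (k - j) * (k + j) / k ^ 2 := fun j _ => by
    field_simp
    ring
  rw [prod_congr rfl h5, prod_div_distrib, prod_mul_distrib, h1, prod_const, card_range, ← h2,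
    ← pow_mul]
  field_simp

/-- The product is exactly (k!)²/(2k)! times a quotient of binomials that is ≥ 1 by maximality of
the central one. Its (2k)! cancels that of `prod_one_sub_div_sq`. -/
theorem prod_one_sub_div_sq_ge (k n : ℕ) :
    (k.factorial : ℝ) ^ 2 / (2 * k).factorial ≤
      ∏ i ∈ range n, (1 - ((k : ℝ) / (k + 1 + i : ℕ)) ^ 2) := by
  have h : ∏ i ∈ range n, (1 - ((k : ℝ) / (k + 1 + i : ℕ)) ^ 2) =
      (n.factorial * (2 * k + n).factorial) / ((k + n).factorial : ℝ) ^ 2 *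
        ((k.factorial : ℝ) ^ 2 / (2 * k).factorial) := by
    induction n with
    | zero =>
      have : (k.factorial : ℝ) ≠ 0 := by positivity
      have : ((2 * k).factorial : ℝ) ≠ 0 := by positivity
      simp; field_simp
    | succ n ih =>
      rw [prod_range_succ, ih, ← add_assoc, ← add_assoc, Nat.factorial_succ, Nat.factorial_succ,
        Nat.factorial_succ]
      push_cast
      have : ((2 * k).factorial : ℝ) ≠ 0 := by positivity
      have : ((k + n).factorial : ℝ) ≠ 0 := by positivity
      have : (k : ℝ) + n + 1 ≠ 0 := by positivity
      have : (k : ℝ) + 1 + n ≠ 0 := by positivity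
      field_simp
      ring
  rw [h]
  refine le_mul_of_one_le_left (by positivity) ?_
  rw [one_le_div (by positivity)]
  have h1 := Nat.choose_le_centralBinom n (k + n)
  have h2 := Nat.add_choose_mul_factorial_mul_factorial (2 * k + n) n
  have h3 := Nat.add_choose_mul_factorial_mul_factorial (k + n) (k + n)
  rw [Nat.centralBinom, show 2 * (k + n) = 2 * k + n + n by ring] at h1
  rw [show k + n + (k + n) = 2 * k + n + n by ring] at h3
  rw [sq]
  norm_cast
  by_contra! hlt
  refine (h2.trans h3.symm).not_lt ?_
  rw [mul_assoc, mul_assoc]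
  rw [mul_comm (2 * k + n).factorial]
  exact Nat.mul_lt_mul_of_le_of_lt h1 hlt (Nat.choose_pos (by omega))

theorem sum_div_sq_le (k n : ℕ) (hk : k ≠ 0) :
    ∑ i ∈ range n, (k : ℝ) / (k + 1 + i : ℕ) ^ 2 ≤ 1 := by
  have hk0 : (0 : ℝ) < k := by exact_mod_cast Nat.pos_of_ne_zero hk
  suffices h : ∑ i ∈ range n, (k : ℝ) / (k + 1 + i : ℕ) ^ 2 ≤ 1 - k / (k + n) by
    have : (0 : ℝ) ≤ k / (k + n) := by positivity
    linarith
  induction n with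
  | zero => simp [hk0.ne']
  | succ n ih =>
    rw [sum_range_succ]
    have : (k : ℝ) / (k + 1 + n : ℕ) ^ 2 ≤ k / (k + n) - k / (k + (n + 1 : ℕ)) := by
      push_cast
      rw [div_sub_div _ _ (by positivity) (by positivity), div_le_div_iff₀ (by positivity) (by positivity)]
      have h1 : (0 : ℝ) ≤ k * (k + n + 1) * k := by positivity
      nlinarith
    linarith

theorem factorial_div_pow_le (k : ℕ) (hk : k ≠ 0) :
    (k.factorial : ℝ) / k ^ k ≤ 2 * (1 / 2) ^ k := by
  induction k, Nat.one_le_iff_ne_zero.2 hk using Nat.le_induction with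
  | base => norm_num
  | succ k hk ih =>
    have hk0 : (0 : ℝ) < k := by exact_mod_cast (by omega : 0 < k)
    have h2 : 2 * (k : ℝ) ^ k ≤ (k + 1) ^ k := by
      have := one_add_mul_le_pow (a := 1 / (k : ℝ))
        ((by norm_num : (-2 : ℝ) ≤ 0).trans (by positivity)) k
      have h3 : (1 + 1 / (k : ℝ)) ^ k = (k + 1) ^ k / k ^ k := by
        rw [← div_pow]; congr 1; field_simp
      rw [h3, le_div_iff₀ (by positivity), mul_one_div_cancel hk0.ne'] at this
      linarith
    have ih := ih (by omega)
    rw [div_le_iff₀ (by positivity)] at ih ⊢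
    rw [Nat.factorial_succ, pow_succ (1 / 2 : ℝ), pow_succ _ k]
    push_cast
    have h4 : 0 ≤ (1 / 2 : ℝ) ^ k * (k + 1) := by positivity
    nlinarith [mul_le_mul_of_nonneg_left h2 h4]

/-- `norm_one_sub_pow_ge` with p = l/u and ε = a/(a+u). The loss is put in exponential form so that
losses add up over a product. -/
theorem one_sub_sq_mul_exp_le_norm {a : ℂ} {B : ℝ} {l u m : ℕ} (hlu : l < u) (hau : a + u ≠ 0)
    (hm : 2 ≤ m) (hwB : ‖(a + l) / (a + u)‖ ≤ B) (hpB : (l : ℝ) / u ≤ B) {x : ℝ}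
    (hεx : ‖a / (a + u)‖ * (m * B ^ (m - 1)) ≤ x) (hx : x ≤ 1 / 2) :
    (1 - ((l : ℝ) / u) ^ 2) * Real.exp (-2 * x) ≤ ‖1 - ((a + l) / (a + u)) ^ m‖ := by
  have hu : (0 : ℝ) < u := by exact_mod_cast (by omega : 0 < u)
  have hp0 : 0 ≤ (l : ℝ) / u := by positivity
  have hp1 : (l : ℝ) / u ≤ 1 := by
    rw [div_le_one hu]
    exact_mod_cast hlu.le
  have hB : 0 ≤ B := hp0.trans hpB
  have hw : (a + l) / (a + u) - ((l / u : ℝ) : ℂ) = a / (a + u) * (1 - ((l / u : ℝ) : ℂ)) := by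
    have : (u : ℂ) ≠ 0 := by exact_mod_cast hu.ne'
    push_cast
    field_simp
    ring
  refine le_trans ?_ (norm_one_sub_pow_ge hp0 hp1 hw hwB hpB (m := m) (by omega))
  have h1 : ((l : ℝ) / u) ^ m ≤ ((l : ℝ) / u) ^ 2 := pow_le_pow_of_le_one hp0 hp1 hm
  have h2 : ((l : ℝ) / u) ^ m ≤ 1 := pow_le_one₀ hp0 hp1
  have hx0 : 0 ≤ x := le_trans (by positivity) hεx
  have h3 := exp_neg_two_mul_le_one_sub hx0 hx
  have h4 := Real.exp_pos (-2 * x)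
  exact mul_le_mul (by linarith) (by linarith) h4.le (by linarith)

/-- Numerators are compared with an ascending factorial of A + 1; each denominator is at least k
e^(-2A/k), costing e^(2A) in total. -/
theorem prod_norm_le {a : ℂ} {A k : ℕ} (hA : ‖a‖ ≤ A) (hk : k ≠ 0) (hAk : 2 * A ≤ k) :
    ∏ j ∈ range k, ‖(a + j) / (a + k)‖ ≤
      Real.exp (2 * A) * (k + A) ^ A * (k.factorial / k ^ k) := by
  have hk0 : (0 : ℝ) < k := by exact_mod_cast Nat.pos_of_ne_zero hk
  have hAk' : 2 * (A : ℝ) ≤ k := by exact_mod_cast hAk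
  have hle : ∀ j ∈ range k, ‖(a + j) / (a + k)‖ ≤ (A + 1 + j) * (Real.exp (2 * (A / k)) / k) := by
    intro j _
    have h1 : ‖a + j‖ ≤ A + 1 + j := by
      refine (norm_add_le _ _).trans ?_
      rw [Complex.norm_natCast]
      linarith
    have h2 : k * Real.exp (-2 * (A / k)) ≤ ‖a + k‖ := by
      have h3 := exp_neg_two_mul_le_one_sub (x := A / k) (by positivity)
        (by rw [div_le_div_iff₀ hk0 two_pos]; linarith)
      have h4 := norm_sub_norm_le (k : ℂ) (-a)
      rw [norm_neg, sub_neg_eq_add, Complex.norm_natCast, add_comm (k : ℂ)] at h4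
      have h5 := mul_le_mul_of_nonneg_left h3 hk0.le
      have h6 : k * (1 - A / k) = (k : ℝ) - A := by field_simp
      linarith
    rw [norm_div]
    calc ‖a + j‖ / ‖a + k‖ ≤ (A + 1 + j) / (k * Real.exp (-2 * (A / k))) := by gcongr
      _ = _ := by
        rw [neg_mul, Real.exp_neg]
        field_simp
  refine (prod_le_prod (fun _ _ => norm_nonneg _) hle).trans ?_
  rw [prod_mul_distrib, prod_const, card_range, div_pow, ← Real.exp_nat_mul]
  have h7 : ∏ j ∈ range k, ((A : ℝ) + 1 + j) ≤ k.factorial * (k + A) ^ A := by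
    have h8 : A.factorial * (A + 1).ascFactorial k = k.factorial * (k + 1).ascFactorial A := by
      rw [Nat.factorial_mul_ascFactorial, Nat.factorial_mul_ascFactorial, add_comm]
    have h9 : (A + 1).ascFactorial k ≤ k.factorial * (k + A) ^ A :=
      (Nat.le_mul_of_pos_left _ A.factorial_pos).trans
        (h8.trans_le (Nat.mul_le_mul_left _ (Nat.ascFactorial_le_pow_add k A)))
    rw [Nat.ascFactorial_eq_prod_range] at h9
    exact_mod_cast h9
  have h10 : (k : ℝ) * (2 * (A / k)) = 2 * A := by field_simp
  rw [h10]
  calc _ ≤ k.factorial * (k + A : ℝ) ^ A * (Real.exp (2 * A) / k ^ k) := by gcongr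
    _ = _ := by ring

/-- Numerators with j < k give (k!/k^k)^m up to a power of k. Denominators below and above k give
(2k)!/k^(2k) and (k!)²/(2k)!, together (k!/k^k)² up to constants. -/
theorem norm_truncTerm_le {m : ℕ} (hm : 2 ≤ m) (a : ℂ) :
    ∃ C : ℝ, ∃ K A : ℕ, ∀ k, K ≤ k → ∀ n,
      ‖truncTerm m a (k + 1 + n) k‖ ≤
        C * ((k + A) ^ A * (k.factorial / k ^ k)) ^ m * (k ^ k / k.factorial) ^ 2 := by
  obtain ⟨A, hA⟩ := exists_nat_ge ‖a‖
  set D : ℝ := 2 * A * (m * 3 ^ (m - 1)) with hD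
  have hD0 : 0 ≤ D := by positivity
  obtain ⟨K, hK⟩ := exists_nat_ge (2 * D)
  -- k ≥ 2A + 2 gives |a+u| ≥ u/2 + 1 for u ≥ k; k ≥ 2D keeps the relative errors at most 1/2.
  refine ⟨2 * Real.exp (2 * D) ^ 2 * Real.exp (2 * A) ^ m, max K (2 * A + 2), A, fun k hk n => ?_⟩
  have hAk : 2 * A + 2 ≤ k := (le_max_right _ _).trans hk
  have hDk : 2 * D ≤ k := hK.trans (by exact_mod_cast (le_max_left _ _).trans hk)
  have hk0 : (0 : ℝ) < k := by exact_mod_cast (by omega : 0 < k)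
  have hlow : ∀ u : ℕ, k ≤ u → (u : ℝ) / 2 + 1 ≤ ‖a + u‖ := fun u hu => by
    have h4 := norm_sub_norm_le (u : ℂ) (-a)
    rw [norm_neg, sub_neg_eq_add, Complex.norm_natCast, add_comm (u : ℂ)] at h4
    have : (2 * A + 2 : ℝ) ≤ u := by exact_mod_cast hAk.trans hu
    linarith
  have hne : ∀ u : ℕ, k ≤ u → a + u ≠ 0 := fun u hu h => by
    have := hlow u hu
    rw [h, norm_zero] at this
    have : (0 : ℝ) ≤ u := u.cast_nonneg
    linarith
  have hup : ∀ l : ℕ, l ≤ k → ‖a + l‖ ≤ 3 / 2 * k := fun l hl => by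
    have h1 := norm_add_le a l
    rw [Complex.norm_natCast] at h1
    have h2 : (2 * A + 2 : ℝ) ≤ k := by exact_mod_cast hAk
    have h3 : (l : ℝ) ≤ k := by exact_mod_cast hl
    linarith
  have hε : ∀ u : ℕ, k ≤ u → ‖a / (a + u)‖ ≤ 2 * A / u := fun u hu => by
    have hu0 : (0 : ℝ) < u := hk0.trans_le (by exact_mod_cast hu)
    have := hlow u hu
    rw [norm_div]
    calc ‖a‖ / ‖a + u‖ ≤ A / (u / 2) := by gcongr; linarith
      _ = _ := by field_simp
  have hw : ∀ l u : ℕ, l ≤ k → k ≤ u → ‖(a + l) / (a + u)‖ ≤ 3 * (k / u) := fun l u hl hu => by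
    have hu0 : (0 : ℝ) < u := hk0.trans_le (by exact_mod_cast hu)
    have := hlow u hu
    rw [norm_div]
    calc ‖a + l‖ / ‖a + u‖ ≤ (3 / 2 * k) / (u / 2) := by gcongr; exacts [hup l hl, by linarith]
      _ = _ := by field_simp
  have hlt : ∏ j ∈ range k, ‖1 - ((a + j) / (a + k)) ^ m‖ ≥
      (2 * k).factorial / (2 * k ^ (2 * k)) * Real.exp (-(2 * D)) := by
    have h1 : Real.exp (-(2 * D)) = ∏ j ∈ range k, Real.exp (-2 * (D / k)) := by
      rw [prod_const, card_range, ← Real.exp_nat_mul]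
      congr 1
      field_simp
    rw [h1, ← prod_one_sub_div_sq k (by omega), ← prod_mul_distrib]
    refine prod_le_prod (fun j hj => ?_) fun j hj => ?_
    · have : (j : ℝ) / k ≤ 1 := by
        rw [div_le_one hk0]
        exact_mod_cast (mem_range.1 hj).le
      have h2 : ((j : ℝ) / k) ^ 2 ≤ 1 := pow_le_one₀ (by positivity) this
      exact mul_nonneg (by linarith) (Real.exp_pos _).le
    · have hj := mem_range.1 hj
      have hjk : (j : ℝ) ≤ k := by exact_mod_cast hj.le
      refine one_sub_sq_mul_exp_le_norm (B := 3) hj (hne k le_rfl) hm ?_ ?_ ?_ ?_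
      · simpa [hk0.ne'] using hw j k hj.le le_rfl
      · rw [div_le_iff₀ hk0]; linarith
      · calc _ ≤ 2 * (A : ℝ) / k * (m * 3 ^ (m - 1)) := by gcongr; exact hε k le_rfl
          _ = D / k := by rw [hD]; ring
      · rw [div_le_div_iff₀ hk0 two_pos]; linarith
  have hgt : ∏ i ∈ range n, ‖1 - ((a + k) / (a + (k + 1 + i : ℕ))) ^ m‖ ≥
      (k.factorial : ℝ) ^ 2 / (2 * k).factorial * Real.exp (-(2 * D)) := by
    have h1 : Real.exp (-(2 * D)) ≤
        ∏ i ∈ range n, Real.exp (-2 * (D * ((k : ℝ) / (k + 1 + i : ℕ) ^ 2))) := by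
      rw [← Real.exp_sum, ← mul_sum, ← mul_sum, Real.exp_le_exp]
      have := mul_le_mul_of_nonneg_left (sum_div_sq_le k n (by omega)) hD0
      linarith
    refine (mul_le_mul (prod_one_sub_div_sq_ge k n) h1 (Real.exp_pos _).le ?_).trans ?_
    · exact le_trans (by positivity) (prod_one_sub_div_sq_ge k n)
    rw [← prod_mul_distrib]
    have hku : ∀ i : ℕ, (k : ℝ) / (k + 1 + i : ℕ) ≤ 1 := fun i => by
      rw [div_le_one (by positivity)]
      exact_mod_cast (by omega : k ≤ k + 1 + i)
    refine prod_le_prod (fun i _ => ?_) fun i _ => ?_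
    · have h2 : ((k : ℝ) / (k + 1 + i : ℕ)) ^ 2 ≤ 1 := pow_le_one₀ (by positivity) (hku i)
      exact mul_nonneg (by linarith) (Real.exp_pos _).le
    · have hu : k ≤ k + 1 + i := by omega
      have hu0 : (0 : ℝ) < (k + 1 + i : ℕ) := by positivity
      have hpos : 0 ≤ (k : ℝ) / (k + 1 + i : ℕ) := by positivity
      -- Letting B shrink like k/u improves the error from order 1/u to k/u², which is summable over
      -- u > k.
      refine one_sub_sq_mul_exp_le_norm (B := 3 * (k / (k + 1 + i : ℕ))) (by omega) (hne _ hu) hm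
        (hw k _ le_rfl hu) (by linarith) ?_ ?_
      · calc _ ≤ 2 * A / (k + 1 + i : ℕ) * (m * (3 * ((k : ℝ) / (k + 1 + i : ℕ))) ^ (m - 1)) := by
              gcongr; exact hε _ hu
          _ = 2 * A / (k + 1 + i : ℕ) * (m * 3 ^ (m - 1)) * ((k : ℝ) / (k + 1 + i : ℕ)) ^ (m - 1) := by
              rw [mul_pow]; ring
          _ ≤ 2 * A / (k + 1 + i : ℕ) * (m * 3 ^ (m - 1)) * ((k : ℝ) / (k + 1 + i : ℕ)) := by
              gcongr
              exact pow_le_of_le_one hpos (hku i) (by omega)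
          _ = _ := by rw [hD]; field_simp
      · calc D * ((k : ℝ) / (k + 1 + i : ℕ) ^ 2) ≤ D * (k / (k : ℝ) ^ 2) := by
              gcongr
          _ = D / k := by field_simp
          _ ≤ 1 / 2 := by rw [div_le_div_iff₀ hk0 two_pos]; linarith
  have hfac1 : ∀ j ∈ range k, ‖(a + j) ^ m / ((a + j) ^ m - (a + k) ^ m)‖ =
      ‖(a + j) / (a + k)‖ ^ m / ‖1 - ((a + j) / (a + k)) ^ m‖ := fun j _ => by
    have := pow_ne_zero m (hne k le_rfl)
    rw [← norm_pow, ← norm_div, div_pow, one_sub_div this, div_div_div_cancel_right₀ this,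
      ← norm_neg, ← div_neg, neg_sub]
  have hfac2 : ∀ i ∈ range n, ‖(a + (k + 1 + i : ℕ)) ^ m /
      ((a + (k + 1 + i : ℕ)) ^ m - (a + k) ^ m)‖ =
      1 / ‖1 - ((a + k) / (a + (k + 1 + i : ℕ))) ^ m‖ := fun i _ => by
    have := pow_ne_zero m (hne (k + 1 + i) (by omega))
    rw [div_pow, one_sub_div this, norm_div, norm_div, one_div_div]
  have hhead : ‖1 / (a + k) ^ m‖ ≤ 1 := by
    rw [norm_div, norm_one, norm_pow]
    refine div_le_one_of_le₀ (one_le_pow₀ ?_) (by positivity)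
    linarith [hlow k le_rfl]
  have hprod := prod_norm_le hA (k := k) (by omega) (by omega)
  rw [truncTerm, norm_mul, norm_prod, prod_range_erase, prod_congr rfl hfac1, prod_congr rfl hfac2,
    prod_div_distrib, prod_div_distrib, prod_pow, prod_const_one]
  calc _ ≤ 1 * ((Real.exp (2 * A) * (k + A) ^ A * (k.factorial / k ^ k)) ^ m /
          ((2 * k).factorial / (2 * k ^ (2 * k)) * Real.exp (-(2 * D))) *
        (1 / ((k.factorial : ℝ) ^ 2 / (2 * k).factorial * Real.exp (-(2 * D))))) := by
        gcongr
    _ = _ := by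
        rw [Real.exp_neg, mul_assoc (Real.exp _), mul_pow (Real.exp _), two_mul k, pow_add]
        field_simp

/-! ### Dominated convergence and the case m ≥ 3 -/

theorem summable_hurwitz {m : ℕ} (hm : 2 ≤ m) (a : ℂ) :
    Summable (fun k : ℕ => 1 / (a + (k : ℂ)) ^ m) := by
  have h := (EisensteinSeries.linear_right_summable a 1 (k := m) (by exact_mod_cast hm)).comp_injective
    Nat.cast_injective
  refine h.congr fun k => ?_
  simp [zpow_natCast]

theorem exists_summable_bound_truncTerm {m : ℕ} (hm : 3 ≤ m) (a : ℂ) :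
    ∃ b : ℕ → ℝ, Summable b ∧ ∃ K, ∀ k, K ≤ k → ∀ n, ‖truncTerm m a (k + 1 + n) k‖ ≤ b k := by
  obtain ⟨C, K, A, h⟩ := norm_truncTerm_le (m := m) (by omega) a
  have hs : Summable fun k : ℕ => (k : ℝ) ^ (A * m) * (1 / 2 : ℝ) ^ k :=
    summable_pow_mul_geometric_of_norm_lt_one (A * m) (by norm_num)
  refine ⟨fun k => |C| * ((1 + A) ^ (A * m) * 2) * ((k : ℝ) ^ (A * m) * (1 / 2) ^ k),
    hs.mul_left _, K + 1, fun k hk n => (h k (by omega) n).trans ?_⟩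
  have hk1 : (1 : ℝ) ≤ k := by exact_mod_cast (by omega : 1 ≤ k)
  have hk0 : (0 : ℝ) < k := by linarith
  have hq := factorial_div_pow_le k (by omega)
  have hq1 : (k.factorial : ℝ) / k ^ k ≤ 1 :=
    div_le_one_of_le₀ (by exact_mod_cast Nat.factorial_le_pow k) (by positivity)
  have hf : (0 : ℝ) < k.factorial := by positivity
  have hkk : (0 : ℝ) < (k : ℝ) ^ k := by positivity
  have h1 : ((k.factorial : ℝ) / k ^ k) ^ m * (k ^ k / k.factorial) ^ 2 ≤ 2 * (1 / 2) ^ k := by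
    -- Two powers of k!/k^k cancel; m ≥ 3 leaves at least one, which decays geometrically.
    obtain ⟨p, rfl⟩ : ∃ p, m = p + 1 + 2 := ⟨m - 3, by omega⟩
    rw [pow_add _ (p + 1) 2, mul_assoc, ← mul_pow, div_mul_div_cancel₀ hkk.ne', div_self hf.ne', one_pow,
      mul_one]
    exact (pow_le_of_le_one (by positivity) hq1 (by omega)).trans hq
  have h2 : (k + A : ℝ) ≤ (1 + A) * k := by
    have : (0 : ℝ) ≤ A := A.cast_nonneg
    nlinarith
  calc C * ((k + A) ^ A * (k.factorial / k ^ k)) ^ m * (k ^ k / k.factorial) ^ 2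
      = C * ((k + A) ^ (A * m) * ((k.factorial / k ^ k) ^ m * (k ^ k / k.factorial) ^ 2)) := by
        rw [mul_pow, pow_mul]; ring
    _ ≤ |C| * (((1 + A) * k) ^ (A * m) * (2 * (1 / 2) ^ k)) := by
        gcongr
        exact le_abs_self C
    _ = _ := by rw [mul_pow]; ring

/-- Tannery's theorem; the finitely many k < K are dominated by ‖g k‖ + 1 for large M. -/
theorem tendsto_sum_range_of_dominated {E : Type*} [NormedAddCommGroup E] [CompleteSpace E]
    {f : ℕ → ℕ → E} {g : ℕ → E} {b : ℕ → ℝ} (hb : Summable b) {K : ℕ}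
    (hfg : ∀ k, Tendsto (f · k) atTop (𝓝 (g k)))
    (hfb : ∀ k, K ≤ k → ∀ M, k < M → ‖f M k‖ ≤ b k) :
    Summable g ∧ Tendsto (fun M => ∑ k ∈ range M, f M k) atTop (𝓝 (∑' k, g k)) := by
  have hgb : ∀ k, K ≤ k → ‖g k‖ ≤ b k := fun k hk =>
    le_of_tendsto (hfg k).norm ((eventually_gt_atTop k).mono fun M hM => hfb k hk M hM)
  set b' : ℕ → ℝ := fun k => if k < K then ‖g k‖ + 1 else b k with hb'
  have hbs : Summable b' := by
    refine hb.congr_cofinite ?_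
    rw [Nat.cofinite_eq_atTop]
    filter_upwards [eventually_ge_atTop K] with k hk
    simp [hb', hk]
  have hev : ∀ᶠ M in atTop, ∀ k ∈ range K, ‖f M k‖ ≤ ‖g k‖ + 1 :=
    (eventually_all_finset _).2 fun k _ => (hfg k).norm.eventually_le_const (by linarith)
  refine ⟨hbs.of_norm_bounded fun k => ?_, ?_⟩
  · by_cases hk : k < K
    · simp [hb', hk]
    · simpa [hb', hk] using hgb k (by omega)
  have h := tendsto_tsum_of_dominated_convergence (𝓕 := atTop)
    (f := fun M k => if k < M then f M k else 0) (g := g) hbs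
    (fun k => (hfg k).congr' ((eventually_gt_atTop k).mono fun M hM => by simp [hM])) ?_
  · refine h.congr fun M => ?_
    rw [tsum_eq_sum (s := range M) fun k hk => if_neg (by simpa using hk)]
    exact sum_congr rfl fun k hk => by simp [mem_range.1 hk]
  · filter_upwards [hev] with M hM k
    by_cases hk : k < K
    · have := hM k (mem_range.2 hk)
      simp only [hb', hk, if_true]
      split_ifs
      · exact this
      · rw [norm_zero]; positivity
    · simp only [hb', hk, if_false]
      split_ifs with hkM
      · exact hfb k (by omega) M hkM
      · rw [norm_zero]; exact (norm_nonneg _).trans (hgb k (by omega))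

theorem tendsto_sum_pfsTerm_of_three_le {m : ℕ} (hm : 3 ≤ m) {a : ℂ} (ha : ∀ j : ℕ, a ≠ -(j : ℂ))
    (hpole : ∀ r ∈ Ico 1 m, ∀ k j : ℕ, a - omegaRoot m ^ r * (a + (k : ℂ)) ≠ -(j : ℂ)) :
    Tendsto (fun N : ℕ => ∑ k ∈ range N, pfsTerm m a k) atTop (𝓝 (hurwitzZetaNat m a)) := by
  obtain ⟨b, hb, K, hK⟩ := exists_summable_bound_truncTerm hm a
  obtain ⟨hg, ht⟩ := tendsto_sum_range_of_dominated hb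
    (tendsto_truncTerm (m := m) (by omega) ha hpole) (K := K) fun k hk M hM => by
      obtain ⟨n, rfl⟩ := Nat.exists_eq_add_of_lt hM
      rw [show k + n + 1 = k + 1 + n by ring]
      exact hK k hk n
  simp_rw [sum_truncTerm (m := m) (by omega) ha hpole] at ht
  have h2 := (summable_hurwitz (m := m) (by omega) a).hasSum.tendsto_sum_nat
  rw [hurwitzZetaNat, tendsto_nhds_unique h2 ht]
  exact hg.hasSum.tendsto_sum_nat

/-! ### Abel summation with weights of bounded variation -/

theorem sum_range_mul_by_parts {R : Type*} [CommRing R] (t w : ℕ → R) (N : ℕ) :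
    ∑ k ∈ range N, t k * w k = (∑ k ∈ range N, t k) * w N +
      ∑ k ∈ range N, (∑ i ∈ range (k + 1), t i) * (w k - w (k + 1)) := by
  induction N with
  | zero => simp
  | succ N ih =>
    rw [sum_range_succ (fun k => t k * w k), ih,
      sum_range_succ (fun k => (∑ i ∈ range (k + 1), t i) * (w k - w (k + 1))),
      sum_range_succ t N]
    ring

/-- Summing by parts leaves S · w n 0 plus errors e k weighted by increments of w n; the boundary
term dies by `hw0`. Increments with small k tend to 0, and for large k the e k are small against
total variation B. -/
theorem tendsto_sum_mul_of_bounded_variation {t : ℕ → ℂ} {S : ℂ} {w : ℕ → ℕ → ℂ} {B : ℝ}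
    (ht : Tendsto (fun N => ∑ k ∈ range N, t k) atTop (𝓝 S))
    (hw1 : ∀ k, Tendsto (w · k) atTop (𝓝 1)) (hw0 : ∀ n, w n (n + 1) = 0)
    (hB : ∀ᶠ n in atTop, ∑ k ∈ range (n + 1), ‖w n k - w n (k + 1)‖ ≤ B) :
    Tendsto (fun n => ∑ k ∈ range (n + 1), t k * w n k) atTop (𝓝 S) := by
  set e : ℕ → ℂ := fun k => ∑ i ∈ range (k + 1), t i - S with he
  have he0 : Tendsto (fun k => ‖e k‖) atTop (𝓝 0) := by
    have := (ht.comp (tendsto_add_atTop_nat 1)).sub_const S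
    rw [sub_self] at this
    simpa using this.norm
  have hrep : ∀ n, ∑ k ∈ range (n + 1), t k * w n k =
      S * w n 0 + ∑ k ∈ range (n + 1), e k * (w n k - w n (k + 1)) := fun n => by
    have h1 : ∑ k ∈ range (n + 1), (w n k - w n (k + 1)) = w n 0 := by
      rw [sum_range_sub', hw0, sub_zero]
    rw [sum_range_mul_by_parts, hw0, mul_zero, zero_add]
    simp only [he, sub_mul]
    rw [sum_sub_distrib, ← mul_sum, h1]
    ring
  simp_rw [hrep]
  have hmain : Tendsto (fun n => ∑ k ∈ range (n + 1), e k * (w n k - w n (k + 1))) atTop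
      (𝓝 0) := by
    rw [Metric.tendsto_nhds]
    intro ε hε
    have hB1 : 0 < |B| + 1 := by positivity
    have hδ : 0 < ε / (2 * (|B| + 1)) := by positivity
    set δ := ε / (2 * (|B| + 1)) with hδdef
    obtain ⟨K, hK⟩ := eventually_atTop.1 (he0.eventually_le_const hδ)
    have hfin : Tendsto (fun n => ∑ k ∈ range K, ‖e k‖ * ‖w n k - w n (k + 1)‖) atTop (𝓝 0) := by
      have := tendsto_finsetSum (range K) fun k _ =>
        (((hw1 k).sub (hw1 (k + 1))).norm).const_mul ‖e k‖
      simpa using this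
    filter_upwards [hB, hfin.eventually_lt_const (half_pos hε), eventually_ge_atTop K]
      with n h1 h2 h3
    rw [dist_zero_right]
    have hle : ∑ k ∈ range (n + 1), ‖e k‖ * ‖w n k - w n (k + 1)‖ ≤
        ∑ k ∈ range K, ‖e k‖ * ‖w n k - w n (k + 1)‖ +
          δ * ∑ k ∈ range (n + 1), ‖w n k - w n (k + 1)‖ := by
      rw [← sum_range_add_sum_Ico _ (show K ≤ n + 1 by omega)]
      gcongr
      rw [mul_sum]
      calc _ ≤ ∑ k ∈ Ico K (n + 1), δ * ‖w n k - w n (k + 1)‖ := by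
            refine sum_le_sum fun k hk => ?_
            gcongr
            exact hK k (mem_Ico.1 hk).1
        _ ≤ _ := by
            refine sum_le_sum_of_subset_of_nonneg (fun k hk => ?_) fun _ _ _ => by positivity
            exact mem_range.2 (mem_Ico.1 hk).2
    have h4 : δ * ∑ k ∈ range (n + 1), ‖w n k - w n (k + 1)‖ ≤ ε / 2 := by
      calc _ ≤ δ * (|B| + 1) := by
            gcongr
            linarith [le_abs_self B]
        _ = ε / 2 := by rw [hδdef]; field_simp
    calc _ ≤ ∑ k ∈ range (n + 1), ‖e k‖ * ‖w n k - w n (k + 1)‖ :=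
          (norm_sum_le _ _).trans_eq (sum_congr rfl fun _ _ => norm_mul _ _)
      _ < ε := by linarith
  simpa using ((hw1 0).const_mul S).add hmain

/-! ### m = 2: variation of the weights -/

theorem omegaRoot_two : omegaRoot 2 = -1 := by
  rw [omegaRoot, ← Complex.exp_pi_mul_I]
  congr 1
  push_cast
  ring

theorem pfsTerm_two (a : ℂ) (k : ℕ) :
    pfsTerm 2 a k = 2 * (-1) ^ k * Complex.Gamma (2 * a + k) /
      (Complex.Gamma a ^ 2 * k.factorial * (a + k) ^ 3) := by
  simp only [pfsTerm, omegaRoot_two, show Ico 1 2 = {1} from rfl, prod_singleton]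
  rw [show a - (-1) ^ 1 * (a + (k : ℂ)) = 2 * a + k by ring]
  norm_num

/-- The ratio of `truncTerm 2 a (n + 1) k` to `pfsTerm 2 a k`. -/
noncomputable def truncRatio (a : ℂ) (n k : ℕ) : ℂ :=
  Complex.GammaSeq (2 * a + k) n / Complex.Gamma (2 * a + k) *
    (Complex.Gamma a / Complex.GammaSeq a n) ^ 2 * (n.descFactorial k / (n : ℂ) ^ k)

theorem truncRatio_self_succ (a : ℂ) (n : ℕ) : truncRatio a n (n + 1) = 0 := by
  simp [truncRatio]

theorem truncRatio_succ {a : ℂ} (h2a : ∀ j : ℕ, 2 * a ≠ -(j : ℂ)) {n k : ℕ} (hn : n ≠ 0)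
    (hk : k ≤ n) :
    truncRatio a n (k + 1) = truncRatio a n k * ((n - k) / (2 * a + k + n + 1)) := by
  have hs : 2 * a + k ≠ 0 := fun h => h2a k (by linear_combination h)
  have hG : Complex.Gamma (2 * a + k) ≠ 0 := Complex.Gamma_ne_zero fun j h =>
    h2a (k + j) (by push_cast; linear_combination h)
  have hd : 2 * a + k + n + 1 ≠ 0 := fun h =>
    h2a (k + n + 1) (by push_cast; linear_combination h)
  have hn0 : (n : ℂ) ≠ 0 := by exact_mod_cast hn
  have h1 := Complex.GammaSeq_add_one_left (2 * a + k) hn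
  rw [div_eq_iff hs] at h1
  rw [truncRatio, truncRatio, Nat.cast_succ, ← add_assoc, h1, Complex.Gamma_add_one _ hs,
    Nat.descFactorial_succ, Nat.cast_mul, Nat.cast_sub hk, pow_succ,
    show (n : ℂ) + 1 + (2 * a + k) = 2 * a + k + n + 1 by ring]
  field_simp
  ring

theorem truncTerm_two_eq {a : ℂ} (ha : ∀ j : ℕ, a ≠ -(j : ℂ))
    (hpole : ∀ r ∈ Ico 1 2, ∀ k j : ℕ, a - omegaRoot 2 ^ r * (a + (k : ℂ)) ≠ -(j : ℂ))
    (h2a : ∀ j : ℕ, 2 * a ≠ -(j : ℂ)) {n k : ℕ} (hn : n ≠ 0) (hk : k ≤ n) :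
    truncTerm 2 a (n + 1) k = pfsTerm 2 a k * truncRatio a n k := by
  obtain ⟨l, rfl⟩ := Nat.exists_eq_add_of_le hk
  have hG : Complex.Gamma (2 * a + k) ≠ 0 := Complex.Gamma_ne_zero fun j h =>
    h2a (k + j) (by push_cast; linear_combination h)
  have hGa := Complex.Gamma_ne_zero ha
  rw [truncTerm_eq le_rfl ha hpole k l hn, pfsTerm_two, truncRatio]
  simp only [omegaRoot_two, show Ico 1 2 = {1} from rfl, prod_singleton]
  rw [show a - (-1) ^ 1 * (a + (k : ℂ)) = 2 * a + k by ring]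
  have h1 := Nat.factorial_mul_descFactorial hk
  rw [Nat.add_sub_cancel_left] at h1
  have hl : (l.factorial : ℂ) ≠ 0 := by exact_mod_cast l.factorial_ne_zero
  rw [← h1]
  push_cast
  rw [div_pow]
  field_simp

/-- With d = 2a+k+n+1, the recurrence gives increment w_k (2a+2k+1)/d and modulus drop |w_k| (|d| -
(n-k))/|d|, where |d| - (n-k) ≥ 2 Re a + 2k + 1 ≥ 1. Hence the variation telescopes. -/
theorem norm_truncRatio_sub_le {a : ℂ} (h2a : ∀ j : ℕ, 2 * a ≠ -(j : ℂ)) {n k : ℕ} (hn : n ≠ 0)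
    (hk : k ≤ n) (hak : 1 ≤ 2 * a.re + 2 * k + 1) :
    ‖truncRatio a n k - truncRatio a n (k + 1)‖ ≤
      (1 + 2 * |a.im|) * (‖truncRatio a n k‖ - ‖truncRatio a n (k + 1)‖) := by
  have hd : 2 * a + k + n + 1 ≠ 0 := fun h =>
    h2a (k + n + 1) (by push_cast; linear_combination h)
  have hdn := norm_pos_iff.2 hd
  have hkn : (k : ℝ) ≤ n := by exact_mod_cast hk
  have h1 : truncRatio a n k - truncRatio a n (k + 1) =
      truncRatio a n k * ((2 * a + 2 * k + 1) / (2 * a + k + n + 1)) := by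
    rw [truncRatio_succ h2a hn hk]
    field_simp
    ring
  have h2 : ‖((n : ℂ) - k)‖ = n - k := by
    rw [← Complex.ofReal_natCast, ← Complex.ofReal_natCast, ← Complex.ofReal_sub,
      Complex.norm_real, Real.norm_of_nonneg (by linarith)]
  have h3 : 2 * a.re + k + n + 1 ≤ ‖2 * a + k + n + 1‖ := by
    simpa using Complex.re_le_norm (2 * a + k + n + 1)
  have h4 : ‖2 * a + 2 * k + 1‖ ≤ (1 + 2 * |a.im|) * (2 * a.re + 2 * k + 1) := by
    have h5 := Complex.norm_le_abs_re_add_abs_im (2 * a + 2 * k + 1)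
    have h6 : (2 * a + 2 * k + 1).re = 2 * a.re + 2 * k + 1 := by simp
    have h7 : (2 * a + 2 * k + 1).im = 2 * a.im := by simp
    rw [h6, h7, abs_of_pos (by linarith), abs_mul, abs_two] at h5
    nlinarith [abs_nonneg a.im]
  rw [h1, truncRatio_succ h2a hn hk, norm_mul, norm_mul, norm_div, norm_div, h2]
  calc ‖truncRatio a n k‖ * (‖2 * a + 2 * k + 1‖ / ‖2 * a + k + n + 1‖)
      ≤ ‖truncRatio a n k‖ * ((1 + 2 * |a.im|) * (‖2 * a + k + n + 1‖ - (n - k)) /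
          ‖2 * a + k + n + 1‖) := by
        gcongr
        refine h4.trans ?_
        gcongr
        linarith
    _ = _ := by field_simp

theorem exists_variation_truncRatio_le {a : ℂ} (h2a : ∀ j : ℕ, 2 * a ≠ -(j : ℂ))
    (hlim : ∀ k, Tendsto (truncRatio a · k) atTop (𝓝 1)) :
    ∃ B : ℝ, ∀ᶠ n in atTop,
      ∑ k ∈ range (n + 1), ‖truncRatio a n k - truncRatio a n (k + 1)‖ ≤ B := by
  obtain ⟨K, hK⟩ := exists_nat_ge (-a.re)
  have hfin : Tendsto (fun n => ∑ k ∈ range K, ‖truncRatio a n k - truncRatio a n (k + 1)‖) atTop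
      (𝓝 0) := by
    have := tendsto_finsetSum (range K) fun k _ => ((hlim k).sub (hlim (k + 1))).norm
    simpa using this
  have hKl : Tendsto (fun n => ‖truncRatio a n K‖) atTop (𝓝 1) := by simpa using (hlim K).norm
  refine ⟨1 + (1 + 2 * |a.im|) * 2, ?_⟩
  filter_upwards [hfin.eventually_le_const one_pos, hKl.eventually_le_const one_lt_two,
    eventually_ge_atTop K, eventually_ne_atTop 0] with n h1 h2 h3 hn
  rw [← sum_range_add_sum_Ico _ (show K ≤ n + 1 by omega)]
  refine add_le_add h1 ?_
  calc _ ≤ ∑ k ∈ Ico K (n + 1),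
        (1 + 2 * |a.im|) * (‖truncRatio a n k‖ - ‖truncRatio a n (k + 1)‖) := by
        refine sum_le_sum fun k hk => ?_
        obtain ⟨hk1, hk2⟩ := mem_Ico.1 hk
        have : (K : ℝ) ≤ k := by exact_mod_cast hk1
        exact norm_truncRatio_sub_le h2a hn (by omega) (by linarith)
    _ = (1 + 2 * |a.im|) * ‖truncRatio a n K‖ := by
        have := sum_Ico_sub (fun k => -‖truncRatio a n k‖) (show K ≤ n + 1 by omega)
        simp only [neg_sub_neg, truncRatio_self_succ, norm_zero] at this
        rw [← mul_sum, this]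
        ring
    _ ≤ _ := by gcongr

/-! ### m = 2: convergence of the series and conclusion -/

/-- Twice the N-th partial sum is t 0 + ∑_{k<N} (t k + t (k+1)) - t N. -/
theorem tendsto_sum_of_summable_add_succ {t : ℕ → ℂ} (ht : Tendsto t atTop (𝓝 0))
    (hs : Summable fun k => t k + t (k + 1)) :
    ∃ S, Tendsto (fun N => ∑ k ∈ range N, t k) atTop (𝓝 S) := by
  refine ⟨(t 0 + ∑' k, (t k + t (k + 1)) - 0) / 2,
    (((tendsto_const_nhds.add hs.hasSum.tendsto_sum_nat).sub ht).div_const 2).congr fun N => ?_⟩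
  rw [div_eq_iff two_ne_zero]
  induction N with
  | zero => simp
  | succ N ih =>
    rw [sum_range_succ, sum_range_succ _ N, add_mul, ← ih]
    ring

/-- Turns Euler's limit into the growth Γ(s+n+1) ~ n^s n!. -/
theorem Gamma_add_natCast_eq_div_GammaSeq {s : ℂ} (hs : ∀ j : ℕ, s ≠ -(j : ℂ)) {n : ℕ}
    (hn : n ≠ 0) :
    Complex.Gamma (s + (n + 1 : ℕ)) =
      Complex.Gamma s / Complex.GammaSeq s n * (n : ℂ) ^ s * n.factorial := by
  have h : ∀ N : ℕ, Complex.Gamma (s + N) = Complex.Gamma s * ∏ j ∈ range N, (s + j) := by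
    intro N
    induction N with
    | zero => simp
    | succ N ih =>
      have : s + N ≠ 0 := fun h => hs N (by linear_combination h)
      rw [prod_range_succ, Nat.cast_succ, ← add_assoc, Complex.Gamma_add_one _ this, ih]
      ring
  have hn0 : (n : ℂ) ^ s ≠ 0 := fun h => hn (by exact_mod_cast ((Complex.cpow_eq_zero_iff _ _).1 h).1)
  have hf : (n.factorial : ℂ) ≠ 0 := by exact_mod_cast n.factorial_ne_zero
  rw [h, Complex.GammaSeq]
  field_simp

theorem pfsTerm_two_succ {a : ℂ} (ha : ∀ j : ℕ, a ≠ -(j : ℂ)) (h2a : ∀ j : ℕ, 2 * a ≠ -(j : ℂ))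
    (k : ℕ) :
    pfsTerm 2 a (k + 1) =
      -pfsTerm 2 a k * ((1 + (2 * a - 1) / (k + 1)) * (1 - 1 / (a + k + 1)) ^ 3) := by
  have hs : 2 * a + k ≠ 0 := fun h => h2a k (by linear_combination h)
  have hk : (k : ℂ) + 1 ≠ 0 := by exact_mod_cast k.succ_ne_zero
  have hak : a + k ≠ 0 := fun h => ha k (by linear_combination h)
  have hak1 : a + k + 1 ≠ 0 := fun h => ha (k + 1) (by push_cast; linear_combination h)
  have hGa := Complex.Gamma_ne_zero ha
  have hf : (k.factorial : ℂ) ≠ 0 := by exact_mod_cast k.factorial_ne_zero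
  rw [pfsTerm_two, pfsTerm_two, Nat.factorial_succ]
  push_cast
  rw [← add_assoc, ← add_assoc, Complex.Gamma_add_one _ hs]
  field_simp
  ring

theorem isBigO_one_div_add_natCast (b : ℂ) :
    (fun n : ℕ => 1 / (b + n)) =O[atTop] fun n : ℕ => ((n : ℝ))⁻¹ := by
  obtain ⟨K, hK⟩ := exists_nat_ge (2 * ‖b‖)
  refine Asymptotics.IsBigO.of_bound 2 ?_
  filter_upwards [eventually_gt_atTop K] with n hn
  have hn' : (K : ℝ) < n := by exact_mod_cast hn
  have hn0 : (0 : ℝ) < n := lt_of_le_of_lt K.cast_nonneg hn'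
  have h4 := norm_sub_norm_le (n : ℂ) (-b)
  rw [norm_neg, sub_neg_eq_add, Complex.norm_natCast, add_comm (n : ℂ)] at h4
  rw [norm_div, norm_one, norm_inv, Real.norm_of_nonneg hn0.le]
  calc 1 / ‖b + n‖ ≤ 1 / (n / 2) := by gcongr; linarith
    _ = _ := by field_simp

theorem isBigO_pfsTerm_two {a : ℂ} (h2a : ∀ j : ℕ, 2 * a ≠ -(j : ℂ)) :
    (fun n : ℕ => pfsTerm 2 a (n + 1)) =O[atTop] fun n : ℕ => (n : ℝ) ^ (2 * a.re - 4) := by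
  have hG := Complex.Gamma_ne_zero h2a
  have h1 : (fun n : ℕ => Complex.Gamma (2 * a) / Complex.GammaSeq (2 * a) n) =O[atTop]
      fun _ : ℕ => (1 : ℝ) :=
    (tendsto_const_nhds.div (Complex.GammaSeq_tendsto_Gamma (2 * a)) hG).isBigO_one ℝ
  have h2 : (fun n : ℕ => (n : ℂ) ^ (2 * a)) =O[atTop] fun n : ℕ => (n : ℝ) ^ (2 * a.re) := by
    refine Asymptotics.IsBigO.of_bound 1 ?_
    filter_upwards [eventually_gt_atTop 0] with n hn
    rw [Complex.norm_natCast_cpow_of_pos hn, one_mul]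
    simpa using le_abs_self _
  have h3 : (fun n : ℕ => 2 * (-1 : ℂ) ^ (n + 1) / Complex.Gamma a ^ 2) =O[atTop]
      fun _ : ℕ => (1 : ℝ) := by
    refine Asymptotics.IsBigO.of_bound (2 / ‖Complex.Gamma a‖ ^ 2) (Eventually.of_forall fun n => ?_)
    simp
  have h := (((h3.mul h1).mul h2).mul (isBigO_one_div_add_natCast 1)).mul
    ((isBigO_one_div_add_natCast (a + 1)).pow 3)
  refine h.congr' ?_ ?_
  · filter_upwards [eventually_ne_atTop 0] with n hn
    have hf : (n.factorial : ℂ) ≠ 0 := by exact_mod_cast n.factorial_ne_zero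
    rw [pfsTerm_two, Gamma_add_natCast_eq_div_GammaSeq h2a hn, Nat.factorial_succ]
    push_cast
    rw [show a + 1 + (n : ℂ) = a + (n + 1) by ring, add_comm (1 : ℂ)]
    field_simp
  · filter_upwards [eventually_gt_atTop 0] with n hn
    have hn0 : (0 : ℝ) < n := by exact_mod_cast hn
    rw [Real.rpow_sub hn0, show (4 : ℝ) = (4 : ℕ) by norm_num, Real.rpow_natCast]
    field_simp

/-- Consecutive terms have ratio -(1 + O(1/n)), so pairing gains one power of n. -/
theorem isBigO_pfsTerm_two_add_succ {a : ℂ} (ha : ∀ j : ℕ, a ≠ -(j : ℂ))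
    (h2a : ∀ j : ℕ, 2 * a ≠ -(j : ℂ)) :
    (fun n : ℕ => pfsTerm 2 a (n + 1) + pfsTerm 2 a (n + 1 + 1)) =O[atTop]
      fun n : ℕ => (n : ℝ) ^ (2 * a.re - 5) := by
  have hx : (fun n : ℕ => (2 * a - 1) * (1 / (2 + n))) =O[atTop] fun n : ℕ => ((n : ℝ))⁻¹ :=
    (isBigO_one_div_add_natCast 2).const_mul_left _
  have hy := isBigO_one_div_add_natCast (a + 2)
  have hinv : Tendsto (fun n : ℕ => ((n : ℝ))⁻¹) atTop (𝓝 0) := tendsto_inv_atTop_nhds_zero_nat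
  have hy0 : Tendsto (fun n : ℕ => 1 / (a + 2 + n)) atTop (𝓝 0) := hy.trans_tendsto hinv
  have hz : (fun n : ℕ => (1 - 1 / (a + 2 + n)) ^ 3) =O[atTop] fun _ : ℕ => (1 : ℝ) :=
    ((tendsto_const_nhds.sub hy0).pow 3).isBigO_one ℝ
  have hv : (fun n : ℕ => 3 - 3 * (1 / (a + 2 + n)) + (1 / (a + 2 + n)) ^ 2) =O[atTop]
      fun _ : ℕ => (1 : ℝ) :=
    ((tendsto_const_nhds.sub (hy0.const_mul 3)).add (hy0.pow 2)).isBigO_one ℝ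
  have hρ : (fun n : ℕ => 1 / (a + 2 + n) * (3 - 3 * (1 / (a + 2 + n)) + (1 / (a + 2 + n)) ^ 2) -
      (2 * a - 1) * (1 / (2 + n)) * (1 - 1 / (a + 2 + n)) ^ 3) =O[atTop]
      fun n : ℕ => ((n : ℝ))⁻¹ * 1 := (hy.mul hv).sub (hx.mul hz)
  refine ((isBigO_pfsTerm_two h2a).mul hρ).congr' (Eventually.of_forall fun n => ?_) ?_
  · beta_reduce
    rw [pfsTerm_two_succ ha h2a (n + 1)]
    push_cast
    rw [show a + ((n : ℂ) + 1) + 1 = a + 2 + n by ring, show (n : ℂ) + 1 + 1 = 2 + n by ring]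
    ring
  · filter_upwards [eventually_gt_atTop 0] with n hn
    have hn0 : (0 : ℝ) < n := by exact_mod_cast hn
    rw [show 2 * a.re - 5 = 2 * a.re - 4 - 1 by ring, Real.rpow_sub_one hn0.ne', mul_one,
      div_eq_mul_inv]

theorem tendsto_sum_pfsTerm_two {a : ℂ} (ha : ∀ j : ℕ, a ≠ -(j : ℂ))
    (hpole : ∀ r ∈ Ico 1 2, ∀ k j : ℕ, a - omegaRoot 2 ^ r * (a + (k : ℂ)) ≠ -(j : ℂ))
    (hre : a.re < 2) :
    Tendsto (fun N : ℕ => ∑ k ∈ range N, pfsTerm 2 a k) atTop (𝓝 (hurwitzZetaNat 2 a)) := by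
  have h2a : ∀ j : ℕ, 2 * a ≠ -(j : ℂ) := fun j h => hpole 1 (by simp) 0 j (by
    rw [omegaRoot_two]
    push_cast
    linear_combination h)
  have ht0 : Tendsto (pfsTerm 2 a) atTop (𝓝 0) := by
    rw [← tendsto_add_atTop_iff_nat 1]
    refine (isBigO_pfsTerm_two h2a).trans_tendsto ?_
    have := (tendsto_rpow_neg_atTop (y := 4 - 2 * a.re) (by linarith)).comp
      (tendsto_natCast_atTop_atTop (R := ℝ))
    simpa [Function.comp_def] using this
  -- The exponent 2 Re a - 5 is below -1 exactly when Re a < 2.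
  have hs : Summable fun k => pfsTerm 2 a k + pfsTerm 2 a (k + 1) := by
    rw [← summable_nat_add_iff 1]
    exact summable_of_isBigO_nat (Real.summable_nat_rpow.2 (by linarith))
      (isBigO_pfsTerm_two_add_succ ha h2a)
  obtain ⟨S, hS⟩ := tendsto_sum_of_summable_add_succ ht0 hs
  have hne : ∀ k, pfsTerm 2 a k ≠ 0 := fun k => by
    have hG : Complex.Gamma (2 * a + k) ≠ 0 := Complex.Gamma_ne_zero fun j h =>
      h2a (k + j) (by push_cast; linear_combination h)
    have hak : a + k ≠ 0 := fun h => ha k (by linear_combination h)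
    have hGa := Complex.Gamma_ne_zero ha
    have hf : (k.factorial : ℂ) ≠ 0 := by exact_mod_cast k.factorial_ne_zero
    rw [pfsTerm_two]
    simp [hG, hak, hGa, hf]
  have hlim : ∀ k, Tendsto (truncRatio a · k) atTop (𝓝 1) := fun k => by
    have h := ((tendsto_truncTerm le_rfl ha hpole k).comp (tendsto_add_atTop_nat 1)).div_const
      (pfsTerm 2 a k)
    rw [div_self (hne k)] at h
    refine h.congr' ?_
    filter_upwards [eventually_ge_atTop k, eventually_ne_atTop 0] with n hk hn
    rw [Function.comp_apply, truncTerm_two_eq ha hpole h2a hn hk, mul_div_cancel_left₀ _ (hne k)]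
  obtain ⟨B, hB⟩ := exists_variation_truncRatio_le h2a hlim
  have h1 := tendsto_sum_mul_of_bounded_variation hS hlim (truncRatio_self_succ a) hB
  have h2 := (summable_hurwitz le_rfl a).hasSum.tendsto_sum_nat.comp (tendsto_add_atTop_nat 1)
  have h3 : Tendsto (fun n => ∑ k ∈ range (n + 1), pfsTerm 2 a k * truncRatio a n k) atTop
      (𝓝 (hurwitzZetaNat 2 a)) := by
    refine h2.congr' ?_
    filter_upwards [eventually_ne_atTop 0] with n hn
    rw [Function.comp_apply, ← sum_truncTerm le_rfl ha hpole]
    exact sum_congr rfl fun k hk =>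
      truncTerm_two_eq ha hpole h2a hn (Nat.lt_succ_iff.1 (mem_range.1 hk))
  -- The weighted sums tend both to S and to ζ(2, a), which identifies S.
  rwa [tendsto_nhds_unique h3 h1]

theorem mainTheorem3 (m : ℕ) (hm : 2 ≤ m) (a : ℂ)
    (ha : ∀ j : ℕ, a ≠ -(j : ℂ))
    (hpole : ∀ r ∈ Finset.Ico 1 m, ∀ k j : ℕ,
      a - omegaRoot m ^ r * (a + (k : ℂ)) ≠ -(j : ℂ))
    (hconv : m = 2 → a.re < 2) :
    Summable (fun k : ℕ => 1 / (a + (k : ℂ)) ^ m) ∧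
      Filter.Tendsto (fun N : ℕ => ∑ k ∈ Finset.range N, pfsTerm m a k) Filter.atTop
        (nhds (hurwitzZetaNat m a)) := by
  refine ⟨summable_hurwitz hm a, ?_⟩
  rcases hm.eq_or_lt with rfl | hm3
  · exact tendsto_sum_pfsTerm_two ha hpole (hconv rfl)
  · exact tendsto_sum_pfsTerm_of_three_le hm3 ha hpole
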